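/- **Setting.** A bag contains infinitely many coins. Independently of each other, each coin is heavy with probability $\alpha\in(0,1/2]$ and light otherwise; a heavy coin shows heads with probability $\theta_1$ and a light coin with probability $\theta_0$, where $0<\theta_0<\theta_1<1$, and flips are independent given the types of the coins. Fix $\delta\in[0,1]$ and an integer $m\ge 1$. Consider a sequential, possibly randomized, algorithm that flips each coin it draws exactly $m$ times: after $n$ coins have been drawn and flipped ($n=0,1,2,\dots$) it decides, from the outcomes of these $nm$ flips and its own independent randomness, either to draw one more coin or to stop and declare one of the $n$ coins drawn so far to be heavy. It knows neither $\alpha,\theta_0,\theta_1$ nor the types of the coins. Let $N=N(\alpha,\theta_0,\theta_1)\in\mathbb{N}\cup\{\infty\}$ be the number of coins drawn when it stops ($N=\infty$ if it never stops). The algorithm is *$\delta$-probably correct* if, for all $\alpha\in(0,1/2]$ and $0<\theta_0<\theta_1<1$, with probability at least $1-\delta$ it stops and the coin it declares is heavy. It is *$\delta$-probably detecting* if, for all such $(\alpha,\theta_0,\theta_1)$, with probability at least $1-\delta$ at least one of the $N$ coins drawn is heavy. (The first property implies the second.) Let $\eta(\theta)=\log\frac{\theta}{1-\theta}$ and $\theta_*=\eta^{-1}\big((1-\alpha)\eta(\theta_0)+\alpha\,\eta(\theta_1)\big)$.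 **Statement.** There is an absolute constant $c'>0$ such that, for all $\delta\in[0,1]$ and $m\ge1$, every algorithm as above that is $\delta$-probably correct, or merely $\delta$-probably detecting, satisfies the following for every $\alpha\in(0,1/2]$ and $0<\theta_0<\theta_1<1$ with $2(\theta_1-\theta_0)\le\min\{\theta_0(1-\theta_0),\theta_1(1-\theta_1)\}$: one has $\theta_*\in[\theta_0,\theta_1]$, and $$\mathbb{E}[N]\;\ge\;\frac{c'\,\min\{\tfrac1m,\ \theta_*(1-\theta_*)\}}{m\left(\alpha(1-\alpha)\frac{(\theta_1-\theta_0)^2}{\theta_*(1-\theta_*)}\right)^2}\,\log\tfrac1\delta\qquad\text{whenever}\quad m\le\frac{\theta_*(1-\theta_*)}{(\theta_1-\theta_0)^2}$$ (for $\delta=0$ the right-hand side is $+\infty$). -/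

import Mathlib

open MeasureTheory ProbabilityTheory
open scoped ENNReal

noncomputable section

/-- The log-odds, i.e. the natural parameter `η` of the Bernoulli (and binomial) family. -/
def logit (θ : ℝ) : ℝ := Real.log (θ / (1 - θ))

/-- `Real.sigmoid` is the inverse `η⁻¹` of the log-odds: right inverse. -/
theorem logit_sigmoid (y : ℝ) : logit (Real.sigmoid y) = y := by
  have h : Real.sigmoid y / (1 - Real.sigmoid y) = Real.exp y := by
    have hpos := Real.exp_pos (-y)
    have h1 : Real.exp y * Real.exp (-y) = 1 := by rw [← Real.exp_add]; simp
    rw [← Real.sigmoid_neg, ← Real.sigmoid_mul_rexp_neg,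
      div_eq_iff (mul_ne_zero (Real.sigmoid_pos y).ne' hpos.ne')]
    linear_combination (-Real.sigmoid y) * h1
  rw [logit, h, Real.log_exp]

/-- `Real.sigmoid` is the inverse `η⁻¹` of the log-odds: left inverse on `(0, 1)`. -/
theorem sigmoid_logit {θ : ℝ} (h0 : 0 < θ) (h1 : θ < 1) : Real.sigmoid (logit θ) = θ := by
  have h : 0 < 1 - θ := by linarith
  rw [Real.sigmoid_def, logit, Real.exp_neg, Real.exp_log (by positivity)]
  field_simp
  ring

/-- The parameters of a most biased coin problem: each coin of the bag is heavy with probability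
`α ∈ (0, 1/2]`, heavy coins have mean `θ₁`, light coins have mean `θ₀`, and `0 < θ₀ < θ₁ < 1`. -/
structure CoinProblem where
  α : unitInterval
  θ₀ : unitInterval
  θ₁ : unitInterval
  α_pos : 0 < (α : ℝ)
  α_le_half : (α : ℝ) ≤ 1 / 2
  θ₀_pos : 0 < (θ₀ : ℝ)
  θ₀_lt_θ₁ : (θ₀ : ℝ) < θ₁
  θ₁_lt_one : (θ₁ : ℝ) < 1

namespace CoinProblem

/-- `θ_* = η⁻¹((1 - α) η(θ₀) + α η(θ₁))`. -/
def θStar (P : CoinProblem) : ℝ :=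
  Real.sigmoid ((1 - (P.α : ℝ)) * logit P.θ₀ + (P.α : ℝ) * logit P.θ₁)

/-- The law of `m` independent flips of a coin with mean `θ` (`true` with probability `θ`). -/
def flipsLaw (m : ℕ) (θ : unitInterval) : Measure (Fin m → Bool) :=
  Measure.pi fun _ => bernoulliMeasure true false θ

/-- The joint law of the hidden type `ξ` of a coin drawn from the bag (`true` means heavy,
which has probability `α`) and of its `m` flips, which given `ξ` are independent with mean
`θ₁` if the coin is heavy and `θ₀` if it is light. -/
def coinLaw (P : CoinProblem) (m : ℕ) : Measure (Bool × (Fin m → Bool)) :=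
  unitInterval.toNNReal P.α • (Measure.dirac true).prod (flipsLaw m P.θ₁) +
    unitInterval.toNNReal (unitInterval.symm P.α) •
      (Measure.dirac false).prod (flipsLaw m P.θ₀)

instance (m : ℕ) (θ : unitInterval) : IsProbabilityMeasure (flipsLaw m θ) := by
  unfold flipsLaw; infer_instance

instance (P : CoinProblem) (m : ℕ) : IsProbabilityMeasure (P.coinLaw m) := by
  constructor
  simp [coinLaw]

/-- The law of the infinite sequence of independent coins in the bag, with their flips. -/
def bagLaw (P : CoinProblem) (m : ℕ) : Measure (ℕ → Bool × (Fin m → Bool)) :=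
  Measure.infinitePi fun _ => P.coinLaw m

end CoinProblem

/-- A (possibly randomized) sequential procedure that flips each coin it draws exactly `m` times.
It may use an internal random seed, independent of the coins. After `n` coins have been drawn and
each of them flipped `m` times, it looks at the outcomes `h` of all these flips and either draws
one more coin (`rule u n h = none`) or stops and declares one of the `n` coins drawn so far to be
heavy (`rule u n h = some i`, the coins being numbered from `0`). It has no access to the hidden
types of the coins nor to the parameters of the problem. -/
structure FixedProcedure (m : ℕ) where
  Seed : Type
  [seedSpace : MeasurableSpace Seed]
  seedLaw : Measure Seed
  [seedProb : IsProbabilityMeasure seedLaw]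
  rule : Seed → (n : ℕ) → (Fin n → Fin m → Bool) → Option (Fin n)
  measurable_rule : ∀ (n : ℕ) (h : Fin n → Fin m → Bool) (o : Option (Fin n)),
    MeasurableSet {u | rule u n h = o}

attribute [instance] FixedProcedure.seedSpace FixedProcedure.seedProb

namespace FixedProcedure

variable {m : ℕ}

/-- A sample point: the seed, and for every coin its hidden type and its `m` flips. -/
abbrev Outcome (A : FixedProcedure m) : Type := A.Seed × (ℕ → Bool × (Fin m → Bool))

/-- The probability measure governing a run of the procedure on the problem `P`. -/
def law (A : FixedProcedure m) (P : CoinProblem) : Measure A.Outcome :=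
  A.seedLaw.prod (P.bagLaw m)

/-- The type `ξ i` of the `i`-th coin: `ω` makes it heavy. -/
def Heavy (A : FixedProcedure m) (ω : A.Outcome) (i : ℕ) : Prop := (ω.2 i).1 = true

/-- The decision that the procedure takes, or would take, after drawing `n` coins. -/
def decision (A : FixedProcedure m) (ω : A.Outcome) (n : ℕ) : Option (Fin n) :=
  A.rule ω.1 n fun k => (ω.2 k).2

/-- The number `N` of coins drawn when the procedure stops (`⊤` if it never stops). -/
def numCoins (A : FixedProcedure m) (ω : A.Outcome) : ℕ∞ :=
  ⨅ (n : ℕ) (_ : A.decision ω n ≠ none), (n : ℕ∞)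

/-- The expectation `E[N]` on the problem `P`. -/
def expectedNumCoins (A : FixedProcedure m) (P : CoinProblem) : ℝ≥0∞ :=
  ∫⁻ ω, (A.numCoins ω : ℝ≥0∞) ∂A.law P

/-- `δ`-probably correct: for all parameters, with probability at least `1 - δ` the procedure
stops and the coin that it declares is heavy. -/
def IsProbablyCorrect (A : FixedProcedure m) (δ : ℝ) : Prop :=
  ∀ P : CoinProblem, 1 - δ ≤ (A.law P).real
    {ω | ∃ n : ℕ, A.numCoins ω = n ∧ ∃ i : Fin n, A.decision ω n = some i ∧ A.Heavy ω i}

/-- The weaker requirement of the detection problem: for all parameters, with probability at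
least `1 - δ` at least one of the `N` coins drawn is heavy (`N` may be infinite). -/
def IsProbablyDetecting (A : FixedProcedure m) (δ : ℝ) : Prop :=
  ∀ P : CoinProblem, 1 - δ ≤ (A.law P).real
    {ω | ∃ i : ℕ, (i : ℕ∞) < A.numCoins ω ∧ A.Heavy ω i}

end FixedProcedure

end

/-! Detection is required for every `α`, so the procedure can hardly ever stop on a bag without
heavy coins. Taking light coins of mean `t` and letting `α → 0` shows that on coins all of mean `t`
it stops with probability at most `δ`, for every `t` in `(0, 1)` (`sum_stopMass_flipsMass_le`). On
the actual bag, if `E[N]` is finite, it stops almost surely. So it tells the mixture law `p` of a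
block of `m` flips from the product law `q` of mean `t`, and a sequential change of measure
(`neg_log_le_mul`) gives `log (1/δ) ≤ KL(p ‖ q) * E[N]`.

It remains to bound the divergence at `t = θ_*`. It is at most the `χ²`-divergence, an explicit
combination of `m`-th powers. Write `v = t (1 - t)`, `μ` for the mixture mean and `K = α (1 - α) (θ₁
- θ₀)² / v`. When `m (θ₁ - θ₀)² ≤ v`, expansion to second order bounds it by `m (μ - t)² / v + m² (K
+ (μ - t)² / v)²` (`sum_mixture_sq_div_le`). Log-odds are linear to first order, so averaging them
instead of the means moves the centre by at most `9 K` (`abs_mixture_mean_sub_le`). The total is of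
order `m K² / v + m² K²`, that is `m K² / min (1/m) v`. -/

noncomputable section

/-! ### Randomized stopping rules: Wald's identity and change of measure. -/

/-- Weights of a randomized stopping rule on sequences in `X`: `halt n h` is the probability of
stopping after exactly `n` observations when these are `h`, and `alive n h` that of going on. -/
structure StoppingWeights (X : Type*) where
  halt : (n : ℕ) → (Fin n → X) → ℝ
  alive : (n : ℕ) → (Fin n → X) → ℝ
  halt_nonneg : ∀ n h, 0 ≤ halt n h
  alive_nonneg : ∀ n h, 0 ≤ alive n h
  halt_zero_add_alive_zero : ∀ h, halt 0 h + alive 0 h = 1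
  halt_succ_add_alive_succ : ∀ n h, halt (n + 1) h + alive (n + 1) h = alive n (Fin.init h)

namespace StoppingWeights

variable {X : Type*}

/-- This is `1 + z ≤ exp z` at `z = a +` the log-likelihood ratio, weighted by the likelihood under
`p`. It replaces the data-processing inequality; the free shift `a` is optimized later. -/
theorem prod_mul_one_add_le {p q : X → ℝ} (hp : ∀ x, 0 < p x) (hq : ∀ x, 0 < q x) (a : ℝ)
    (n : ℕ) (h : Fin n → X) :
    (∏ i, p (h i)) * (1 + a + ∑ i, Real.log (q (h i) / p (h i))) ≤
      Real.exp a * ∏ i, q (h i) := by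
  have hprod : (∏ i, p (h i)) * Real.exp (∑ i, Real.log (q (h i) / p (h i))) =
      ∏ i, q (h i) := by
    rw [Real.exp_sum, ← Finset.prod_mul_distrib]
    refine Finset.prod_congr rfl fun i _ => ?_
    rw [Real.exp_log (div_pos (hq _) (hp _)), mul_div_cancel₀ _ (hp _).ne']
  rw [← hprod, mul_left_comm, ← Real.exp_add]
  refine mul_le_mul_of_nonneg_left ?_ (Finset.prod_nonneg fun i _ => (hp _).le)
  linarith [Real.add_one_le_exp (a + ∑ i, Real.log (q (h i) / p (h i)))]

variable [Fintype X] (W : StoppingWeights X)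

/-- Probability of stopping after exactly `n` independent observations with mass function `p`. -/
def stopMass (p : X → ℝ) (n : ℕ) : ℝ := ∑ h : Fin n → X, W.halt n h * ∏ i, p (h i)

/-- Probability of not stopping before `n + 1` independent observations with mass function `p`. -/
def aliveMass (p : X → ℝ) (n : ℕ) : ℝ := ∑ h : Fin n → X, W.alive n h * ∏ i, p (h i)

theorem sum_fin_succ_eq_sum_snoc {M : Type*} [AddCommMonoid M] (n : ℕ)
    (F : (Fin (n + 1) → X) → M) :
    ∑ h, F h = ∑ h : Fin n → X, ∑ x : X, F (Fin.snoc h x) := by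
  rw [← (Fin.snocEquiv (fun _ : Fin (n + 1) => X)).sum_comp, Fintype.sum_prod_type,
    Finset.sum_comm]
  rfl

/-- Decomposition of a sum over histories at the next observation, for the total score of `l`. -/
theorem sum_succ_score (p l : X → ℝ) (hp : ∑ x, p x = 1) (c : ℝ) (n : ℕ) :
    ∑ h : Fin (n + 1) → X, W.halt (n + 1) h * ((∏ i, p (h i)) * (c + ∑ i, l (h i))) +
      ∑ h : Fin (n + 1) → X, W.alive (n + 1) h * ((∏ i, p (h i)) * (c + ∑ i, l (h i))) =
    ∑ h : Fin n → X, W.alive n h * ((∏ i, p (h i)) * (c + ∑ i, l (h i))) +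
      (∑ x, p x * l x) * W.aliveMass p n := by
  rw [← Finset.sum_add_distrib]
  -- Whether observation `n + 1` is made depends only on the first `n`, so the new observation can
  -- be averaged out.
  simp_rw [← add_mul, W.halt_succ_add_alive_succ]
  rw [sum_fin_succ_eq_sum_snoc, aliveMass, Finset.mul_sum, ← Finset.sum_add_distrib]
  refine Finset.sum_congr rfl fun h _ => ?_
  simp only [Fin.init_snoc, Fin.prod_univ_castSucc, Fin.sum_univ_castSucc, Fin.snoc_castSucc,
    Fin.snoc_last]
  have h1 : ∀ x, W.alive n h * (((∏ i, p (h i)) * p x) * (c + (∑ i, l (h i) + l x))) =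
      (W.alive n h * ((∏ i, p (h i)) * (c + ∑ i, l (h i)))) * p x +
        (W.alive n h * ∏ i, p (h i)) * (p x * l x) := fun x => by ring
  simp_rw [h1]
  rw [Finset.sum_add_distrib, ← Finset.mul_sum, ← Finset.mul_sum, hp]
  ring

/-- Wald's identity for the truncated stopping rule. -/
theorem wald (p l : X → ℝ) (hp : ∑ x, p x = 1) (c : ℝ) (T : ℕ) :
    ∑ n ∈ Finset.range (T + 1),
      ∑ h : Fin n → X, W.halt n h * ((∏ i, p (h i)) * (c + ∑ i, l (h i))) +
      ∑ h : Fin T → X, W.alive T h * ((∏ i, p (h i)) * (c + ∑ i, l (h i))) =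
    c + (∑ x, p x * l x) * ∑ n ∈ Finset.range T, W.aliveMass p n := by
  induction T with
  | zero =>
    have := W.halt_zero_add_alive_zero default
    simp only [zero_add, Finset.range_one, Finset.sum_singleton, Finset.univ_unique,
      Finset.univ_eq_empty, Finset.prod_empty, Finset.sum_empty, Finset.range_zero]
    linear_combination c * this
  | succ T ih =>
    rw [Finset.sum_range_succ, add_assoc, W.sum_succ_score p l hp, ← add_assoc, ih,
      Finset.sum_range_succ _ T]
    ring

theorem sum_stopMass_add_aliveMass (p : X → ℝ) (hp : ∑ x, p x = 1) (T : ℕ) :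
    ∑ n ∈ Finset.range (T + 1), W.stopMass p n + W.aliveMass p T = 1 := by
  simpa [stopMass, aliveMass] using W.wald p (fun _ => 0) hp 1 T

theorem stopMass_nonneg {p : X → ℝ} (hp : ∀ x, 0 ≤ p x) (n : ℕ) : 0 ≤ W.stopMass p n :=
  Finset.sum_nonneg fun _ _ =>
    mul_nonneg (W.halt_nonneg _ _) (Finset.prod_nonneg fun _ _ => hp _)

theorem aliveMass_nonneg {p : X → ℝ} (hp : ∀ x, 0 ≤ p x) (n : ℕ) : 0 ≤ W.aliveMass p n :=
  Finset.sum_nonneg fun _ _ =>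
    mul_nonneg (W.alive_nonneg _ _) (Finset.prod_nonneg fun _ _ => hp _)

/-- Change of measure for a truncated stopping rule, in linearized form. -/
theorem change_of_measure {p q : X → ℝ} (hp : ∀ x, 0 < p x) (hq : ∀ x, 0 < q x)
    (hp1 : ∑ x, p x = 1) (a b : ℝ) (T : ℕ) :
    1 + a + (b - a) * W.aliveMass p T +
        (∑ x, p x * Real.log (q x / p x)) * ∑ n ∈ Finset.range T, W.aliveMass p n ≤
      Real.exp a * ∑ n ∈ Finset.range (T + 1), W.stopMass q n +
        Real.exp b * W.aliveMass q T := by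
  have hwald := W.wald p (fun x => Real.log (q x / p x)) hp1 (1 + a) T
  have h1 : ∀ n, ∑ h : Fin n → X, W.halt n h *
      ((∏ i, p (h i)) * (1 + a + ∑ i, Real.log (q (h i) / p (h i)))) ≤
      Real.exp a * W.stopMass q n := fun n => by
    rw [stopMass, Finset.mul_sum]
    refine Finset.sum_le_sum fun h _ => ?_
    exact (mul_le_mul_of_nonneg_left (prod_mul_one_add_le hp hq a n h)
      (W.halt_nonneg n h)).trans_eq (mul_left_comm _ _ _)
  -- Surviving histories get their own shift `b`; the first term corrects for the constant `1 + a`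
  -- that Wald's identity puts on all histories.
  have h2 : (b - a) * W.aliveMass p T + ∑ h : Fin T → X, W.alive T h *
      ((∏ i, p (h i)) * (1 + a + ∑ i, Real.log (q (h i) / p (h i)))) ≤
      Real.exp b * W.aliveMass q T := by
    rw [aliveMass, aliveMass, Finset.mul_sum, Finset.mul_sum, ← Finset.sum_add_distrib]
    refine Finset.sum_le_sum fun h _ => ?_
    have := mul_le_mul_of_nonneg_left (prod_mul_one_add_le hp hq b T h) (W.alive_nonneg _ h)
    linarith
  have h3 := Finset.sum_le_sum (s := Finset.range (T + 1)) fun n _ => h1 n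
  rw [← Finset.mul_sum] at h3
  linarith

/-- If under `q` the rule stops with probability at most `δ`, the expected number `B` of
observations under `p` is at least `log (1 / δ)` divided by the relative entropy. -/
theorem neg_log_le_mul {p q : X → ℝ} (hp : ∀ x, 0 < p x) (hq : ∀ x, 0 < q x)
    (hp1 : ∑ x, p x = 1) (hq1 : ∑ x, q x = 1) {δ D B : ℝ} (hδ : 0 < δ) (hD0 : 0 ≤ D)
    (hD : -D ≤ ∑ x, p x * Real.log (q x / p x))
    (hmass : ∀ T, ∑ n ∈ Finset.range (T + 1), W.stopMass q n ≤ δ)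
    (hB : ∀ T, ∑ n ∈ Finset.range T, W.aliveMass p n ≤ B) :
    -Real.log δ ≤ D * B := by
  -- The partial sums of `aliveMass p` are truncated expectations of the stopping time, so their
  -- boundedness forces almost sure stopping under `p`.
  have hA : Filter.Tendsto (W.aliveMass p) Filter.atTop (nhds 0) :=
    (summable_of_sum_range_le (W.aliveMass_nonneg fun x => (hp x).le) hB).tendsto_atTop_zero
  have key : ∀ a b : ℝ, 1 + a - D * B ≤ Real.exp a * δ + Real.exp b := fun a b => by
    have hlim : Filter.Tendsto (fun T => 1 + a + (b - a) * W.aliveMass p T - D * B)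
        Filter.atTop (nhds (1 + a + (b - a) * 0 - D * B)) :=
      (tendsto_const_nhds.add (hA.const_mul _)).sub_const _
    rw [mul_zero, add_zero] at hlim
    refine le_of_tendsto' hlim fun T => ?_
    have h1 := W.change_of_measure hp hq hp1 a b T
    have hS : 0 ≤ ∑ n ∈ Finset.range T, W.aliveMass p n :=
      Finset.sum_nonneg fun n _ => W.aliveMass_nonneg (fun x => (hp x).le) n
    have h2 := mul_le_mul_of_nonneg_right hD hS
    have h3 := mul_le_mul_of_nonneg_left (hB T) hD0
    have h4 := mul_le_mul_of_nonneg_left (hmass T) (Real.exp_pos a).le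
    have h5 : W.aliveMass q T ≤ 1 := by
      have := W.sum_stopMass_add_aliveMass q hq1 T
      have := Finset.sum_nonneg fun n (_ : n ∈ Finset.range (T + 1)) =>
        W.stopMass_nonneg (fun x => (hq x).le) n
      linarith
    have h6 := mul_le_mul_of_nonneg_left h5 (Real.exp_pos b).le
    linarith
  -- The mass surviving under `q` need not vanish; letting `b → -∞` removes it. The choice `a = -log
  -- δ` makes the stopping term equal to `1`.
  have h := ge_of_tendsto' ((Real.tendsto_exp_atBot).const_add (Real.exp (-Real.log δ) * δ))
    (key (-Real.log δ))
  rw [Real.exp_neg, Real.exp_log hδ, inv_mul_cancel₀ hδ.ne'] at h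
  linarith

end StoppingWeights

/-! ### Mean log-odds against log-odds of the mean. -/

theorem abs_log_sub_log_sub_le {x μ : ℝ} (hμ : 0 < μ) (hx : |x - μ| ≤ μ / 2) :
    |Real.log x - Real.log μ - (x - μ) / μ| ≤ 2 * ((x - μ) ^ 2 / μ ^ 2) := by
  have hxpos : 0 < x := by linarith [(abs_le.1 hx).1]
  have hy : |(μ - x) / μ| ≤ 1 / 2 := by
    rw [abs_div, abs_of_pos hμ, div_le_iff₀ hμ, abs_sub_comm]
    linarith
  have h := Real.abs_log_sub_add_sum_range_le (lt_of_le_of_lt hy (by norm_num)) 1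
  have h1 : 1 - (μ - x) / μ = x / μ := by field_simp; ring
  rw [h1, Real.log_div hxpos.ne' hμ.ne'] at h
  have h2 : Real.log x - Real.log μ - (x - μ) / μ =
      ∑ i ∈ Finset.range 1, ((μ - x) / μ) ^ (i + 1) / (↑i + 1) +
        (Real.log x - Real.log μ) := by
    simp; ring
  rw [h2]
  refine h.trans ?_
  rw [div_le_iff₀ (by linarith)]
  norm_num
  have h3 : (x - μ) ^ 2 / μ ^ 2 = ((μ - x) / μ) ^ 2 := by rw [div_pow]; ring
  rw [h3]
  nlinarith [sq_nonneg ((μ - x) / μ), sq_abs ((μ - x) / μ)]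

/-- The linear Taylor terms at the mean cancel on averaging; the quadratic remainders average to the
variance `a (1 - a) (y - x)²`. -/
theorem abs_log_jensen_gap_le {a x y μ : ℝ} (ha0 : 0 ≤ a) (ha1 : a ≤ 1) (hμ : 0 < μ)
    (hμ' : μ = (1 - a) * x + a * y) (hxy : |y - x| ≤ μ / 2) :
    |(1 - a) * Real.log x + a * Real.log y - Real.log μ| ≤
      2 * (a * (1 - a) * (y - x) ^ 2 / μ ^ 2) := by
  have ex : x - μ = -(a * (y - x)) := by rw [hμ']; ring
  have ey : y - μ = (1 - a) * (y - x) := by rw [hμ']; ring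
  have hx := abs_log_sub_log_sub_le (x := x) hμ (by
    rw [ex, abs_neg, abs_mul, abs_of_nonneg ha0]; nlinarith [abs_nonneg (y - x)])
  have hy := abs_log_sub_log_sub_le (x := y) hμ (by
    rw [ey, abs_mul, abs_of_nonneg (by linarith : 0 ≤ 1 - a)]; nlinarith [abs_nonneg (y - x)])
  have h1 : (1 - a) * Real.log x + a * Real.log y - Real.log μ =
      (1 - a) * (Real.log x - Real.log μ - (x - μ) / μ) +
        a * (Real.log y - Real.log μ - (y - μ) / μ) := by
    rw [ex, ey]; ring
  have h2 : 2 * (a * (1 - a) * (y - x) ^ 2 / μ ^ 2) =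
      (1 - a) * (2 * ((x - μ) ^ 2 / μ ^ 2)) + a * (2 * ((y - μ) ^ 2 / μ ^ 2)) := by
    rw [ex, ey]; ring
  rw [h1, h2]
  refine (abs_add_le _ _).trans ?_
  rw [abs_mul, abs_mul, abs_of_nonneg ha0, abs_of_nonneg (by linarith : 0 ≤ 1 - a)]
  exact add_le_add (mul_le_mul_of_nonneg_left hx (by linarith))
    (mul_le_mul_of_nonneg_left hy ha0)

theorem logit_eq_log_sub_log {θ : ℝ} (h0 : 0 < θ) (h1 : θ < 1) :
    logit θ = Real.log θ - Real.log (1 - θ) :=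
  Real.log_div h0.ne' (by linarith)

theorem abs_logit_jensen_gap_le {a x y μ : ℝ} (ha0 : 0 ≤ a) (ha1 : a ≤ 1) (hx0 : 0 < x)
    (hx1 : x < 1) (hy0 : 0 < y) (hy1 : y < 1) (hμ0 : 0 < μ) (hμ1 : μ < 1)
    (hμ : μ = (1 - a) * x + a * y) (hxy : |y - x| ≤ μ * (1 - μ) / 2) :
    |(1 - a) * logit x + a * logit y - logit μ| ≤
      2 * (a * (1 - a) * (y - x) ^ 2 / (μ * (1 - μ)) ^ 2) := by
  have h1μ : 0 < 1 - μ := by linarith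
  have h1 := abs_log_jensen_gap_le ha0 ha1 hμ0 hμ (by nlinarith)
  have h2 := abs_log_jensen_gap_le (x := 1 - x) (y := 1 - y) ha0 ha1 h1μ
    (by rw [hμ]; ring) (by
      have : 1 - y - (1 - x) = -(y - x) := by ring
      rw [this, abs_neg]; nlinarith)
  have h3 : (1 - a) * logit x + a * logit y - logit μ =
      ((1 - a) * Real.log x + a * Real.log y - Real.log μ) -
      ((1 - a) * Real.log (1 - x) + a * Real.log (1 - y) - Real.log (1 - μ)) := by
    rw [logit_eq_log_sub_log hx0 hx1, logit_eq_log_sub_log hy0 hy1,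
      logit_eq_log_sub_log hμ0 hμ1]
    ring
  rw [h3]
  refine (abs_sub _ _).trans ((add_le_add h1 h2).trans ?_)
  have h4 : 1 - y - (1 - x) = -(y - x) := by ring
  rw [h4, neg_sq, ← mul_add]
  refine mul_le_mul_of_nonneg_left ?_ zero_le_two
  have hK : 0 ≤ a * (1 - a) * (y - x) ^ 2 :=
    mul_nonneg (mul_nonneg ha0 (by linarith)) (sq_nonneg _)
  rw [div_add_div _ _ (by positivity) (by positivity), ← mul_pow]
  refine div_le_div_of_nonneg_right ?_ (by positivity)
  -- Hence `1/μ² + 1/(1 - μ)² ≤ 1/(μ (1 - μ))²`, which combines the bounds for the two logarithms.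
  have h5 : (1 - μ) ^ 2 + μ ^ 2 ≤ 1 := by nlinarith
  have h6 := mul_le_mul_of_nonneg_left h5 hK
  linarith

/-- A mean value bound, since `logit` has derivative `1/(θ (1 - θ))`; the variance is evaluated at
`y` with an error of at most `y - x`. -/
theorem sub_le_mul_logit_sub_logit {x y : ℝ} (hx0 : 0 < x) (hxy : x ≤ y) (hy1 : y < 1) :
    y - x ≤ (y * (1 - y) + (y - x)) * (logit y - logit x) := by
  have hy0 : 0 < y := by linarith
  have hx1 : 0 < 1 - x := by linarith
  have hy1' : 0 < 1 - y := by linarith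
  have h1 := Real.one_sub_inv_le_log_of_pos (div_pos hy0 hx0)
  have h2 := Real.one_sub_inv_le_log_of_pos (div_pos hx1 hy1')
  rw [inv_div, Real.log_div hy0.ne' hx0.ne'] at h1
  rw [inv_div, Real.log_div hx1.ne' hy1'.ne'] at h2
  rw [logit_eq_log_sub_log hy0 hy1, logit_eq_log_sub_log hx0 (by linarith)]
  have h3 : 0 ≤ y - x := by linarith
  have h4 : (y - x) / (y * (1 - x)) ≤ (1 - x / y) + (1 - (1 - y) / (1 - x)) := by
    have : (1 - x / y) + (1 - (1 - y) / (1 - x)) = (y - x) * (1 - x + y) / (y * (1 - x)) := by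
      field_simp; ring
    rw [this]
    refine div_le_div_of_nonneg_right ?_ (by positivity)
    nlinarith
  rw [div_le_iff₀ (by positivity)] at h4
  have h5 : 0 ≤ (1 - x / y) + (1 - (1 - y) / (1 - x)) := by
    have a1 : x / y ≤ 1 := (div_le_one hy0).2 hxy
    have a2 : (1 - y) / (1 - x) ≤ 1 := (div_le_one hx1).2 (by linarith)
    linarith
  refine h4.trans ?_
  rw [mul_comm]
  refine mul_le_mul ?_ (by linarith) h5 (by nlinarith)
  nlinarith

theorem min_le_mul_one_sub {x y t : ℝ} (h : t ∈ Set.Icc x y) :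
    min (x * (1 - x)) (y * (1 - y)) ≤ t * (1 - t) := by
  obtain ⟨h1, h2⟩ := h
  rcases le_total (t + x) 1 with h3 | h3
  · exact (min_le_left _ _).trans (by nlinarith)
  · exact (min_le_right _ _).trans (by nlinarith)

/-- The mean of a mixture is close to the point whose log-odds are the mean log-odds. -/
theorem abs_mixture_mean_sub_le {a x y t : ℝ} (ha0 : 0 ≤ a) (ha1 : a ≤ 1) (hx0 : 0 < x)
    (hxy : x < y) (hy1 : y < 1)
    (hsep : 2 * (y - x) ≤ min (x * (1 - x)) (y * (1 - y)))
    (ht : t ∈ Set.Icc x y) (hlogit : logit t = (1 - a) * logit x + a * logit y) :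
    |(1 - a) * x + a * y - t| ≤ 9 * (a * (1 - a) * ((y - x) ^ 2 / (t * (1 - t)))) := by
  obtain ⟨μ, hμ⟩ : ∃ μ, μ = (1 - a) * x + a * y := ⟨_, rfl⟩
  rw [← hμ]
  have hμI : μ ∈ Set.Icc x y := by
    constructor <;> rw [hμ] <;> nlinarith
  have hvμ := hsep.trans (min_le_mul_one_sub hμI)
  have hvt := hsep.trans (min_le_mul_one_sub ht)
  have hgap := abs_logit_jensen_gap_le ha0 ha1 hx0 (by linarith) (by linarith) hy1
    (by linarith [hμI.1]) (by linarith [hμI.2]) hμ (by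
      rw [abs_of_pos (by linarith)]; linarith)
  rw [← hlogit] at hgap
  obtain ⟨hμ1, hμ2⟩ := hμI
  obtain ⟨ht1, ht2⟩ := ht
  have hvt0 : 0 < t * (1 - t) := by linarith
  have hvμ0 : 0 < μ * (1 - μ) := by linarith
  -- The variance function is 1-Lipschitz, and `|μ - t| ≤ y - x` is at most half of `μ (1 - μ)`.
  have hcmp : 2 / 3 * (t * (1 - t)) ≤ μ * (1 - μ) := by nlinarith
  have hcmp' : μ * (1 - μ) ≤ t * (1 - t) + |μ - t| := by
    rcases abs_cases (μ - t) with ⟨h, h'⟩ | ⟨h, h'⟩ <;> rw [h] <;> nlinarith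
  have hd : |μ - t| ≤ y - x := abs_le.2 ⟨by linarith, by linarith⟩
  have hmean : |μ - t| ≤ 2 * (t * (1 - t)) * |logit t - logit μ| := by
    rcases le_total μ t with h | h
    · have h1 := sub_le_mul_logit_sub_logit (by linarith : 0 < μ) h (by linarith)
      rw [abs_sub_comm, abs_of_nonneg (by linarith : 0 ≤ t - μ)] at *
      refine h1.trans ((mul_le_mul_of_nonneg_left (le_abs_self _) (by linarith)).trans ?_)
      exact mul_le_mul_of_nonneg_right (by linarith) (abs_nonneg _)
    · have h1 := sub_le_mul_logit_sub_logit (by linarith : 0 < t) h (by linarith)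
      rw [abs_sub_comm (logit t)]
      rw [abs_of_nonneg (by linarith : 0 ≤ μ - t)] at *
      refine h1.trans ((mul_le_mul_of_nonneg_left (le_abs_self _) (by linarith)).trans ?_)
      exact mul_le_mul_of_nonneg_right (by linarith) (abs_nonneg _)
  have hK : 0 ≤ a * (1 - a) * (y - x) ^ 2 :=
    mul_nonneg (mul_nonneg ha0 (by linarith)) (sq_nonneg _)
  refine hmean.trans ((mul_le_mul_of_nonneg_left hgap (by linarith)).trans ?_)
  have hsq : (2 / 3 * (t * (1 - t))) ^ 2 ≤ (μ * (1 - μ)) ^ 2 :=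
    pow_le_pow_left₀ (by linarith) hcmp 2
  have h6 := div_le_div_of_nonneg_left hK (by positivity) hsq
  -- The constant is `9 = 2 * 2 * (3/2)²`.
  calc 2 * (t * (1 - t)) * (2 * (a * (1 - a) * (y - x) ^ 2 / (μ * (1 - μ)) ^ 2))
      ≤ 2 * (t * (1 - t)) * (2 * (a * (1 - a) * (y - x) ^ 2 / (2 / 3 * (t * (1 - t))) ^ 2)) := by
        gcongr
    _ = 9 * (a * (1 - a) * ((y - x) ^ 2 / (t * (1 - t)))) := by
        have : t * (1 - t) ≠ 0 := hvt0.ne'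
        generalize t * (1 - t) = v at this ⊢
        field_simp
        norm_num

/-! ### The `χ²`-divergence between a mixture and a product law. -/

/-- The probability of the outcomes `x` of `m` independent flips of a coin with mean `θ`. -/
def flipsMass (m : ℕ) (θ : ℝ) (x : Fin m → Bool) : ℝ := ∏ j, if x j then θ else 1 - θ

theorem flipsMass_pos (m : ℕ) {θ : ℝ} (h0 : 0 < θ) (h1 : θ < 1) (x : Fin m → Bool) :
    0 < flipsMass m θ x :=
  Finset.prod_pos fun j _ => by split_ifs <;> linarith

theorem sum_prod_bool (m : ℕ) (f : Bool → ℝ) :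
    ∑ x : Fin m → Bool, ∏ j, f (x j) = (f true + f false) ^ m := by
  rw [← Fintype.piFinset_univ, ← Finset.prod_univ_sum]
  simp

theorem sum_flipsMass (m : ℕ) (θ : ℝ) : ∑ x, flipsMass m θ x = 1 := by
  have := sum_prod_bool m fun b => if b then θ else 1 - θ
  simpa [flipsMass] using this

/-- The sum factorizes over the flips, and one flip contributes `ab/t + (1-a)(1-b)/(1-t)`. -/
theorem sum_flipsMass_mul_div (m : ℕ) (a b : ℝ) {t : ℝ} (h0 : 0 < t) (h1 : t < 1) :
    ∑ x, flipsMass m a x * flipsMass m b x / flipsMass m t x =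
      (1 + (a - t) * (b - t) / (t * (1 - t))) ^ m := by
  have h := sum_prod_bool m fun c =>
    (if c then a else 1 - a) * (if c then b else 1 - b) / (if c then t else 1 - t)
  simp only [Finset.prod_div_distrib, Finset.prod_mul_distrib] at h
  refine h.trans ?_
  have : 0 < 1 - t := by linarith
  congr 1
  simp only [if_true, Bool.false_eq_true, if_false]
  field_simp
  ring

theorem one_add_pow_le {m : ℕ} {t : ℝ} (hm : 1 ≤ m) (ht : |m * t| ≤ 1) :
    (1 + t) ^ m ≤ 1 + m * t + (m * t) ^ 2 := by
  have hm' : (1 : ℝ) ≤ m := by exact_mod_cast hm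
  have ht1 : |t| ≤ 1 := by
    rw [abs_mul, Nat.abs_cast] at ht
    nlinarith [abs_nonneg t]
  have h1 : (1 + t) ^ m ≤ Real.exp (m * t) := by
    rw [Real.exp_nat_mul]
    exact pow_le_pow_left₀ (by linarith [(abs_le.1 ht1).1])
      (by linarith [Real.add_one_le_exp t]) m
  have h2 := (abs_le.1 (Real.abs_exp_sub_one_sub_id_le ht)).2
  linarith

/-- Bound on the `χ²`-divergence of a mixture of two products of Bernoulli laws from a product. -/
theorem sum_mixture_sq_div_le {m : ℕ} (hm : 1 ≤ m) {a x y t : ℝ} (ha0 : 0 ≤ a) (ha1 : a ≤ 1)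
    (ht0 : 0 < t) (ht1 : t < 1) (ht : t ∈ Set.Icc x y)
    (hmv : m * ((y - x) ^ 2 / (t * (1 - t))) ≤ 1) :
    ∑ z, ((1 - a) * flipsMass m x z + a * flipsMass m y z) ^ 2 / flipsMass m t z ≤
      1 + m * (((1 - a) * x + a * y - t) ^ 2 / (t * (1 - t))) +
        m ^ 2 * ((a * (1 - a) * (y - x) ^ 2 + ((1 - a) * x + a * y - t) ^ 2) /
          (t * (1 - t))) ^ 2 := by
  have hv : 0 < t * (1 - t) := mul_pos ht0 (by linarith)
  obtain ⟨hx, hy⟩ := ht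
  have hG : ∀ b c : ℝ, |b - t| ≤ y - x → |c - t| ≤ y - x →
      ∑ z, flipsMass m b z * flipsMass m c z / flipsMass m t z ≤
        1 + m * ((b - t) * (c - t) / (t * (1 - t))) +
          (m * ((b - t) * (c - t) / (t * (1 - t)))) ^ 2 := fun b c hb hc => by
    rw [sum_flipsMass_mul_div m b c ht0 ht1]
    refine one_add_pow_le hm (le_trans ?_ hmv)
    rw [abs_mul, Nat.abs_cast, abs_div, abs_of_pos hv, abs_mul, sq]
    have : 0 ≤ y - x := by linarith
    gcongr
  have hxt : |x - t| ≤ y - x := abs_le.2 ⟨by linarith, by linarith⟩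
  have hyt : |y - t| ≤ y - x := abs_le.2 ⟨by linarith, by linarith⟩
  have h1 : ∑ z, ((1 - a) * flipsMass m x z + a * flipsMass m y z) ^ 2 / flipsMass m t z =
      (1 - a) ^ 2 * ∑ z, flipsMass m x z * flipsMass m x z / flipsMass m t z +
      2 * (a * (1 - a)) * ∑ z, flipsMass m x z * flipsMass m y z / flipsMass m t z +
      a ^ 2 * ∑ z, flipsMass m y z * flipsMass m y z / flipsMass m t z := by
    rw [Finset.mul_sum, Finset.mul_sum, Finset.mul_sum, ← Finset.sum_add_distrib,
      ← Finset.sum_add_distrib]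
    exact Finset.sum_congr rfl fun z _ => by ring
  have h2 := mul_le_mul_of_nonneg_left (hG x x hxt hxt) (sq_nonneg (1 - a))
  have h3 := mul_le_mul_of_nonneg_left (hG x y hxt hyt)
    (by nlinarith : 0 ≤ 2 * (a * (1 - a)))
  have h4 := mul_le_mul_of_nonneg_left (hG y y hyt hyt) (sq_nonneg a)
  rw [h1]
  -- The first-order terms form the square of the bias of the mean about `t`, the second-order ones
  -- the square of the second moment about `t`, which is variance plus squared bias.
  refine (add_le_add (add_le_add h2 h3) h4).trans_eq ?_
  generalize t * (1 - t) = v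
  ring

/-- Relative entropy is at most the `χ²`-divergence, by `log u ≥ 1 - 1/u`. -/
theorem sum_mul_log_div_ge {X : Type*} [Fintype X] {p q : X → ℝ} (hp : ∀ x, 0 < p x)
    (hq : ∀ x, 0 < q x) (hp1 : ∑ x, p x = 1) :
    -(∑ x, p x ^ 2 / q x - 1) ≤ ∑ x, p x * Real.log (q x / p x) := by
  have : -(∑ x, p x ^ 2 / q x - 1) = ∑ x, p x * (1 - p x / q x) := by
    simp_rw [mul_sub, mul_one, Finset.sum_sub_distrib, hp1, neg_sub, ← mul_div_assoc, ← sq]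
  rw [this]
  refine Finset.sum_le_sum fun x _ => mul_le_mul_of_nonneg_left ?_ (hp x).le
  have := Real.one_sub_inv_le_log_of_pos (div_pos (hq x) (hp x))
  rwa [inv_div] at this

/-- The relative entropy of the mixture with respect to the product law with mean log-odds. -/
theorem chiSq_mixture_le {m : ℕ} (hm : 1 ≤ m) {a x y t : ℝ} (ha0 : 0 ≤ a) (ha1 : a ≤ 1)
    (hx0 : 0 < x) (hxy : x < y) (hy1 : y < 1)
    (hsep : 2 * (y - x) ≤ min (x * (1 - x)) (y * (1 - y)))
    (ht : t ∈ Set.Icc x y) (hlogit : logit t = (1 - a) * logit x + a * logit y)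
    (hmv : m * ((y - x) ^ 2 / (t * (1 - t))) ≤ 1) :
    ∑ z, ((1 - a) * flipsMass m x z + a * flipsMass m y z) ^ 2 / flipsMass m t z - 1 ≤
      130 * (m * (a * (1 - a) * ((y - x) ^ 2 / (t * (1 - t)))) ^ 2 /
        min (1 / (m : ℝ)) (t * (1 - t))) := by
  have hgap := abs_mixture_mean_sub_le ha0 ha1 hx0 hxy hy1 hsep ht hlogit
  have hchi := sum_mixture_sq_div_le hm ha0 ha1 (by linarith [ht.1]) (by linarith [ht.2]) ht hmv
  have hv2 := hsep.trans (min_le_mul_one_sub ht)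
  have hv1 : t * (1 - t) ≤ 1 / 4 := by nlinarith [sq_nonneg (t - 1 / 2)]
  generalize (1 - a) * x + a * y - t = g at hgap hchi
  generalize t * (1 - t) = v at *
  have hv : 0 < v := by linarith
  have hm0 : (0 : ℝ) < m := by exact_mod_cast hm
  obtain ⟨K, hK⟩ : ∃ K, K = a * (1 - a) * ((y - x) ^ 2 / v) := ⟨_, rfl⟩
  have hKv : a * (1 - a) * (y - x) ^ 2 = K * v := by rw [hK]; field_simp
  have hK0 : 0 ≤ K := by
    rw [hK]; exact mul_nonneg (mul_nonneg ha0 (by linarith)) (by positivity)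
  rw [← hK] at hgap ⊢
  rw [hKv] at hchi
  have hg2 : g ^ 2 ≤ 81 * K ^ 2 := by
    have := pow_le_pow_left₀ (abs_nonneg g) hgap 2
    rw [sq_abs] at this
    linarith
  have hKle : 16 * K ≤ v := by
    have h1 : a * (1 - a) ≤ 1 / 4 := by nlinarith [sq_nonneg (a - 1 / 2)]
    have h2 : (y - x) ^ 2 ≤ v ^ 2 / 4 := by nlinarith
    have h3 : a * (1 - a) * (y - x) ^ 2 ≤ 1 / 4 * (v ^ 2 / 4) :=
      mul_le_mul h1 h2 (sq_nonneg _) (by norm_num)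
    rw [hKv] at h3
    nlinarith
  -- Here `g² ≤ 81 K² ≤ (81/16) K v`, and `1 + 81/16 ≤ 7`. The final constant is `130 = 81 + 7²`.
  have hsum : (K * v + g ^ 2) / v ≤ 7 * K := by
    rw [div_le_iff₀ hv]; nlinarith
  have hsum2 : ((K * v + g ^ 2) / v) ^ 2 ≤ 49 * K ^ 2 := by
    have := pow_le_pow_left₀ (by positivity) hsum 2
    linarith
  obtain ⟨w, hw⟩ : ∃ w, w = min (1 / (m : ℝ)) v := ⟨_, rfl⟩
  rw [← hw]
  have hw0 : 0 < w := by rw [hw]; exact lt_min (by positivity) hv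
  have hwm : (m : ℝ) ≤ 1 / w := by
    rw [le_div_iff₀ hw0]
    have : w ≤ 1 / m := hw ▸ min_le_left _ _
    rwa [le_div_iff₀ hm0, mul_comm] at this
  have hwv : 1 / v ≤ 1 / w := one_div_le_one_div_of_le hw0 (hw ▸ min_le_right _ _)
  have e1 : (m : ℝ) * (g ^ 2 / v) ≤ 81 * (m * K ^ 2 / w) := by
    calc (m : ℝ) * (g ^ 2 / v) = m * g ^ 2 * (1 / v) := by ring
      _ ≤ m * (81 * K ^ 2) * (1 / w) := by gcongr
      _ = _ := by ring
  have e2 : (m : ℝ) ^ 2 * ((K * v + g ^ 2) / v) ^ 2 ≤ 49 * (m * K ^ 2 / w) := by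
    calc (m : ℝ) ^ 2 * ((K * v + g ^ 2) / v) ^ 2 ≤ m ^ 2 * (49 * K ^ 2) := by gcongr
      _ = m * (49 * K ^ 2) * m := by ring
      _ ≤ m * (49 * K ^ 2) * (1 / w) := by gcongr
      _ = _ := by ring
  linarith

/-! ### Runs of a procedure as finite sums over histories. -/

theorem flipsLaw_real_singleton (m : ℕ) (θ : unitInterval) (x : Fin m → Bool) :
    (CoinProblem.flipsLaw m θ).real {x} = flipsMass m θ x := by
  rw [measureReal_def, CoinProblem.flipsLaw, Measure.pi_singleton, ENNReal.toReal_prod]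
  refine Finset.prod_congr rfl fun j _ => ?_
  rw [← measureReal_def, bernoulliMeasure_real_apply _ (MeasurableSet.of_discrete)]
  cases x j <;> simp

/-- Mass function of the `m` flips of a coin drawn from the bag. -/
def CoinProblem.mass (P : CoinProblem) (m : ℕ) (x : Fin m → Bool) : ℝ :=
  (1 - (P.α : ℝ)) * flipsMass m P.θ₀ x + (P.α : ℝ) * flipsMass m P.θ₁ x

theorem coinLaw_real_prod (P : CoinProblem) (m : ℕ) (s : Set Bool) (x : Fin m → Bool) :
    (P.coinLaw m).real (s ×ˢ {x}) =
      (1 - (P.α : ℝ)) * ((Measure.dirac false).real s * flipsMass m P.θ₀ x) +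
        (P.α : ℝ) * ((Measure.dirac true).real s * flipsMass m P.θ₁ x) := by
  rw [CoinProblem.coinLaw, measureReal_add_apply, measureReal_nnreal_smul_apply,
    measureReal_nnreal_smul_apply, measureReal_prod_prod, measureReal_prod_prod,
    flipsLaw_real_singleton, flipsLaw_real_singleton, add_comm]
  simp

theorem coinLaw_real_light (P : CoinProblem) (m : ℕ) (x : Fin m → Bool) :
    (P.coinLaw m).real {(false, x)} = (1 - (P.α : ℝ)) * flipsMass m P.θ₀ x := by
  rw [← Set.singleton_prod_singleton, coinLaw_real_prod]
  simp [measureReal_def]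

theorem coinLaw_real_flips (P : CoinProblem) (m : ℕ) (x : Fin m → Bool) :
    (P.coinLaw m).real {y | y.2 = x} = P.mass m x := by
  have h : {y : Bool × (Fin m → Bool) | y.2 = x} = Set.univ ×ˢ {x} := by
    ext; simp
  rw [h, coinLaw_real_prod, CoinProblem.mass, probReal_univ, probReal_univ, one_mul, one_mul]

instance (P : CoinProblem) (m : ℕ) : IsProbabilityMeasure (P.bagLaw m) := by
  unfold CoinProblem.bagLaw; infer_instance

namespace FixedProcedure

variable {m : ℕ} (A : FixedProcedure m)

instance (P : CoinProblem) : IsProbabilityMeasure (A.law P) := by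
  unfold law; infer_instance

/-- The seeds for which the procedure has not stopped after `n` coins with outcomes `h`. -/
def aliveSet (n : ℕ) (h : Fin n → Fin m → Bool) : Set A.Seed :=
  {u | ∀ k (hk : k ≤ n), A.rule u k (fun i => h (Fin.castLE hk i)) = none}

/-- The seeds for which the procedure stops after exactly `n` coins with outcomes `h`. -/
def stopSet (n : ℕ) (h : Fin n → Fin m → Bool) : Set A.Seed :=
  {u | (∀ k (hk : k < n), A.rule u k (fun i => h (Fin.castLE hk.le i)) = none) ∧
    A.rule u n h ≠ none}

theorem measurableSet_aliveSet (n : ℕ) (h : Fin n → Fin m → Bool) :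
    MeasurableSet (A.aliveSet n h) := by
  simp only [aliveSet, Set.ofPred_forall]
  exact MeasurableSet.iInter fun k => MeasurableSet.iInter fun hk => A.measurable_rule _ _ _

theorem measurableSet_stopSet (n : ℕ) (h : Fin n → Fin m → Bool) :
    MeasurableSet (A.stopSet n h) := by
  refine MeasurableSet.inter (s₁ := {u | ∀ k (hk : k < n),
    A.rule u k (fun i => h (Fin.castLE hk.le i)) = none}) ?_ (A.measurable_rule n h none).compl
  simp only [Set.ofPred_forall]
  exact MeasurableSet.iInter fun k => MeasurableSet.iInter fun hk => A.measurable_rule _ _ _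

theorem seedLaw_stopSet_add_aliveSet (n : ℕ) (h : Fin n → Fin m → Bool) :
    A.seedLaw.real (A.stopSet n h) + A.seedLaw.real (A.aliveSet n h) =
      A.seedLaw.real
        {u | ∀ k (hk : k < n), A.rule u k (fun i => h (Fin.castLE hk.le i)) = none} := by
  rw [← measureReal_union _ (A.measurableSet_aliveSet n h)]
  · congr 1
    ext u
    simp only [aliveSet, stopSet, Set.mem_union, Set.mem_ofPred_eq]
    constructor
    · rintro (⟨h1, -⟩ | h1)
      · exact h1
      · exact fun k hk => h1 k hk.le
    · intro h1
      by_cases h2 : A.rule u n h = none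
      · right
        intro k hk
        rcases hk.lt_or_eq with h3 | rfl
        · exact h1 k h3
        · exact h2
      · exact Or.inl ⟨h1, h2⟩
  · rw [Set.disjoint_left]
    exact fun u h1 h2 => h1.2 (h2 n le_rfl)

/-- The probabilities, over the seed, of stopping after given observations. -/
def weights : StoppingWeights (Fin m → Bool) where
  halt n h := A.seedLaw.real (A.stopSet n h)
  alive n h := A.seedLaw.real (A.aliveSet n h)
  halt_nonneg _ _ := measureReal_nonneg
  alive_nonneg _ _ := measureReal_nonneg
  halt_zero_add_alive_zero h := by
    rw [seedLaw_stopSet_add_aliveSet]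
    simp
  halt_succ_add_alive_succ n h := by
    rw [seedLaw_stopSet_add_aliveSet]
    congr 1
    ext u
    simp only [aliveSet, Set.mem_ofPred_eq, Nat.lt_succ_iff]
    rfl

/-- Probability of an event on the seed and on the first `n` coins, each of which is observed
through a family of disjoint sets. -/
theorem law_real_cylinder (P : CoinProblem) (n : ℕ) (S : (Fin n → Fin m → Bool) → Set A.Seed)
    (hS : ∀ h, MeasurableSet (S h)) (B : (Fin m → Bool) → Set (Bool × (Fin m → Bool)))
    (hB : ∀ x, ∀ y ∈ B x, y.2 = x) :
    MeasurableSet {ω : A.Outcome | ω.1 ∈ S (fun i => (ω.2 i).2) ∧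
      ∀ i : Fin n, ω.2 i ∈ B (ω.2 i).2} ∧
    (A.law P).real {ω | ω.1 ∈ S (fun i => (ω.2 i).2) ∧ ∀ i : Fin n, ω.2 i ∈ B (ω.2 i).2} =
      ∑ h : Fin n → Fin m → Bool, A.seedLaw.real (S h) * ∏ i, (P.coinLaw m).real (B (h i)) := by
  -- Splitting by the observed flips `h` turns the event into a disjoint union of rectangles, on
  -- which seed and coins are independent.
  have hset : {ω : A.Outcome | ω.1 ∈ S (fun i => (ω.2 i).2) ∧
      ∀ i : Fin n, ω.2 i ∈ B (ω.2 i).2} =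
      ⋃ h ∈ (Finset.univ : Finset (Fin n → Fin m → Bool)),
        S h ×ˢ {f : ℕ → Bool × (Fin m → Bool) | ∀ i : Fin n, f i ∈ B (h i)} := by
    ext ω
    simp only [Set.mem_ofPred_eq, Finset.mem_univ, Set.iUnion_true, Set.mem_iUnion, Set.mem_prod]
    constructor
    · exact fun h => ⟨_, h⟩
    · rintro ⟨h, h1, h2⟩
      have : (fun i : Fin n => (ω.2 i).2) = h := funext fun i => hB _ _ (h2 i)
      subst this
      exact ⟨h1, h2⟩
  have hcyl : ∀ h : Fin n → Fin m → Bool,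
      {f : ℕ → Bool × (Fin m → Bool) | ∀ i : Fin n, f i ∈ B (h i)} =
      Set.pi (Finset.range n) fun k => if hk : k < n then B (h ⟨k, hk⟩) else Set.univ := by
    intro h
    ext f
    simp only [Set.mem_ofPred_eq, Set.mem_pi, Finset.coe_range, Set.mem_Iio]
    constructor
    · intro h1 k hk
      rw [dif_pos hk]
      exact h1 ⟨k, hk⟩
    · intro h1 i
      have := h1 i i.2
      rwa [dif_pos i.2] at this
  have hmeas : ∀ h : Fin n → Fin m → Bool, MeasurableSet
      (S h ×ˢ {f : ℕ → Bool × (Fin m → Bool) | ∀ i : Fin n, f i ∈ B (h i)}) := fun h => by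
    refine (hS h).prod ?_
    rw [hcyl]
    exact MeasurableSet.pi (Finset.countable_toSet _) fun k _ => MeasurableSet.of_discrete
  rw [hset]
  refine ⟨Finset.measurableSet_biUnion _ fun h _ => hmeas h, ?_⟩
  rw [measureReal_biUnion_finset _ fun h _ => hmeas h]
  · refine Finset.sum_congr rfl fun h _ => ?_
    rw [law, measureReal_prod_prod, CoinProblem.bagLaw, hcyl, measureReal_def (Measure.infinitePi _),
      Measure.infinitePi_pi _ fun k _ => MeasurableSet.of_discrete, ENNReal.toReal_prod,
      Finset.prod_range]
    simp [measureReal_def]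
  · intro h _ h' _ hne
    rw [Function.onFun, Set.disjoint_left]
    rintro ω ⟨-, h1⟩ ⟨-, h2⟩
    exact hne (funext fun i => (hB _ _ (h1 i)).symm.trans (hB _ _ (h2 i)))

theorem lt_numCoins_iff (ω : A.Outcome) (n : ℕ) :
    (n : ℕ∞) < A.numCoins ω ↔ ω.1 ∈ A.aliveSet n fun i => (ω.2 i).2 := by
  rw [numCoins, ← ENat.add_one_le_iff (ENat.natCast_ne_top n), le_iInf₂_iff]
  constructor
  · intro h k hk
    by_contra hne
    have h1 := h k hne
    norm_cast at h1
    omega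
  · intro h k hne
    by_contra! hk
    norm_cast at hk
    exact hne (h k (by omega))

theorem numCoins_of_mem_stopSet (ω : A.Outcome) (n : ℕ)
    (h : ω.1 ∈ A.stopSet n fun i => (ω.2 i).2) : A.numCoins ω = n := by
  refine le_antisymm (iInf₂_le n h.2) (le_iInf₂ fun k hne => ?_)
  by_contra! hk
  norm_cast at hk
  exact hne (h.1 k hk)

end FixedProcedure

/-! ### Expected number of coins, and what detection forces. -/

namespace FixedProcedure

variable {m : ℕ} (A : FixedProcedure m)

theorem IsProbablyCorrect.isProbablyDetecting {A : FixedProcedure m} {δ : ℝ}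
    (h : A.IsProbablyCorrect δ) : A.IsProbablyDetecting δ := fun P => by
  refine (h P).trans (measureReal_mono ?_)
  rintro ω ⟨n, hn, i, -, hi⟩
  exact ⟨i, by rw [hn]; exact_mod_cast i.2, hi⟩

theorem law_real_lt_numCoins (P : CoinProblem) (n : ℕ) :
    MeasurableSet {ω : A.Outcome | (n : ℕ∞) < A.numCoins ω} ∧
    (A.law P).real {ω | (n : ℕ∞) < A.numCoins ω} = A.weights.aliveMass (P.mass m) n := by
  have h := A.law_real_cylinder P n (A.aliveSet n) (A.measurableSet_aliveSet n)
    (fun x => {y | y.2 = x}) (fun x y hy => hy)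
  simp only [Set.mem_ofPred_eq, implies_true, and_true, coinLaw_real_flips] at h
  simp only [lt_numCoins_iff]
  exact h

theorem sum_indicator_le_toENNReal (N : ℕ∞) (T : ℕ) :
    ∑ n ∈ Finset.range T, (Set.Iio N).indicator 1 (n : ℕ∞) ≤ (N : ℝ≥0∞) := by
  induction N using ENat.recTopCoe with
  | top => simp
  | coe k =>
    have h : ∀ n ∈ Finset.range T, (Set.Iio (k : ℕ∞)).indicator (1 : ℕ∞ → ℝ≥0∞) (n : ℕ∞) =
        if n < k then 1 else 0 := fun n _ => by
      simp [Set.indicator_apply]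
    rw [Finset.sum_congr rfl h, Finset.sum_boole, ENat.toENNReal_coe]
    norm_cast
    calc ((Finset.range T).filter (· < k)).card ≤ (Finset.range k).card :=
          Finset.card_le_card fun n hn => Finset.mem_range.2 (Finset.mem_filter.1 hn).2
      _ = k := Finset.card_range k

/-- Tail-sum formula: the left side is `E[min(N, T)]`. -/
theorem ofReal_sum_aliveMass_le (P : CoinProblem) (T : ℕ) :
    ENNReal.ofReal (∑ n ∈ Finset.range T, A.weights.aliveMass (P.mass m) n) ≤
      A.expectedNumCoins P := by
  have h1 : ENNReal.ofReal (∑ n ∈ Finset.range T, A.weights.aliveMass (P.mass m) n) =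
      ∑ n ∈ Finset.range T, A.law P {ω | (n : ℕ∞) < A.numCoins ω} := by
    simp_rw [← (A.law_real_lt_numCoins P _).2]
    rw [ENNReal.ofReal_sum_of_nonneg fun _ _ => measureReal_nonneg]
    simp
  have h2 : ∑ n ∈ Finset.range T, A.law P {ω | (n : ℕ∞) < A.numCoins ω} =
      ∫⁻ ω, ∑ n ∈ Finset.range T,
        {ω | (n : ℕ∞) < A.numCoins ω}.indicator (1 : A.Outcome → ℝ≥0∞) ω ∂A.law P := by
    rw [lintegral_finsetSum _ fun n _ =>
      measurable_one.indicator (A.law_real_lt_numCoins P n).1]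
    exact Finset.sum_congr rfl fun n _ =>
      (lintegral_indicator_one (A.law_real_lt_numCoins P n).1).symm
  rw [h1, h2, expectedNumCoins]
  exact lintegral_mono fun ω => sum_indicator_le_toENNReal (A.numCoins ω) T

/-- A detecting procedure stops while all drawn coins are light with probability at most `δ`. -/
theorem sum_pow_mul_stopMass_le {δ : ℝ} (hA : A.IsProbablyDetecting δ) (P : CoinProblem) (T : ℕ) :
    ∑ n ∈ Finset.range T, (1 - (P.α : ℝ)) ^ n *
      A.weights.stopMass (flipsMass m P.θ₀) n ≤ δ := by
  have h : ∀ n, MeasurableSet {ω : A.Outcome | ω.1 ∈ A.stopSet n (fun i => (ω.2 i).2) ∧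
      ∀ i : Fin n, (ω.2 i).1 = false} ∧
      (A.law P).real {ω | ω.1 ∈ A.stopSet n (fun i => (ω.2 i).2) ∧
        ∀ i : Fin n, (ω.2 i).1 = false} =
      (1 - (P.α : ℝ)) ^ n * A.weights.stopMass (flipsMass m P.θ₀) n := fun n => by
    have h := A.law_real_cylinder P n (A.stopSet n) (A.measurableSet_stopSet n)
      (fun x => {(false, x)}) (by rintro x _ rfl; rfl)
    simp only [Set.mem_singleton_iff, Prod.ext_iff, and_true, coinLaw_real_light] at h
    refine ⟨h.1, h.2.trans ?_⟩
    rw [StoppingWeights.stopMass, Finset.mul_sum]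
    refine Finset.sum_congr rfl fun x _ => ?_
    rw [Finset.prod_mul_distrib, Finset.prod_const, Finset.card_fin, mul_left_comm]
    rfl
  simp_rw [← (h _).2]
  rw [← measureReal_biUnion_finset _ fun n _ => (h n).1]
  -- Stopping with only light coins drawn excludes detection, so it is confined to the remaining
  -- probability `δ`.
  · have hdisj : Disjoint {ω : A.Outcome | ∃ i : ℕ, (i : ℕ∞) < A.numCoins ω ∧ A.Heavy ω i}
        (⋃ n ∈ Finset.range T, {ω : A.Outcome | ω.1 ∈ A.stopSet n (fun i => (ω.2 i).2) ∧
          ∀ i : Fin n, (ω.2 i).1 = false}) := by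
      rw [Set.disjoint_left]
      rintro ω ⟨i, hi, hheavy⟩ hω
      simp only [Set.mem_iUnion] at hω
      obtain ⟨n, -, hn, hlight⟩ := hω
      rw [A.numCoins_of_mem_stopSet ω n hn] at hi
      have hin : i < n := by exact_mod_cast hi
      have := hlight ⟨i, hin⟩
      rw [Heavy] at hheavy
      simp [hheavy] at this
    have hunion := measureReal_union (μ := A.law P) hdisj
      (Finset.measurableSet_biUnion _ fun n _ => (h n).1) (measure_ne_top _ _) (measure_ne_top _ _)
    have h1 := hA P
    have h2 := measureReal_le_one (μ := A.law P) (s :=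
      {ω : A.Outcome | ∃ i : ℕ, (i : ℕ∞) < A.numCoins ω ∧ A.Heavy ω i} ∪
        (⋃ n ∈ Finset.range T, {ω : A.Outcome | ω.1 ∈ A.stopSet n (fun i => (ω.2 i).2) ∧
          ∀ i : Fin n, (ω.2 i).1 = false}))
    linarith
  · intro n _ k _ hne
    rw [Function.onFun, Set.disjoint_left]
    rintro ω ⟨h1, -⟩ ⟨h2, -⟩
    refine hne ?_
    have := (A.numCoins_of_mem_stopSet ω n h1).symm.trans (A.numCoins_of_mem_stopSet ω k h2)
    exact_mod_cast this

/-- A detecting procedure that is fed with coins all of the same mean stops with probability at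
most `δ`. -/
theorem sum_stopMass_flipsMass_le {δ : ℝ} (hA : A.IsProbablyDetecting δ) {t : ℝ} (h0 : 0 < t)
    (h1 : t < 1) (T : ℕ) :
    ∑ n ∈ Finset.range T, A.weights.stopMass (flipsMass m t) n ≤ δ := by
  -- For a fixed horizon `T`, the factors `(1 - a) ^ n` tend to `1` as the proportion `a` of heavy
  -- coins tends to `0`.
  have hlim : Filter.Tendsto (fun a : ℝ => ∑ n ∈ Finset.range T, (1 - a) ^ n *
      A.weights.stopMass (flipsMass m t) n) (nhdsWithin 0 (Set.Ioi 0))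
      (nhds (∑ n ∈ Finset.range T, (1 - 0) ^ n * A.weights.stopMass (flipsMass m t) n)) := by
    refine (Continuous.tendsto ?_ 0).mono_left nhdsWithin_le_nhds
    fun_prop
  simp only [sub_zero, one_pow, one_mul] at hlim
  refine le_of_tendsto hlim ?_
  filter_upwards [Ioo_mem_nhdsGT (show (0 : ℝ) < 1 / 2 by norm_num)] with a ha
  -- The heavy mean is irrelevant here; `(1 + t) / 2` is just some value strictly between `t` and
  -- `1`.
  exact A.sum_pow_mul_stopMass_le hA
    { α := ⟨a, ha.1.le, by linarith [ha.2]⟩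
      θ₀ := ⟨t, h0.le, h1.le⟩
      θ₁ := ⟨(1 + t) / 2, by linarith, by linarith⟩
      α_pos := ha.1
      α_le_half := ha.2.le
      θ₀_pos := h0
      θ₀_lt_θ₁ := by simp only; linarith
      θ₁_lt_one := by simp only; linarith } T

end FixedProcedure

/-! ### The lower bound. -/

theorem CoinProblem.mass_pos (P : CoinProblem) (m : ℕ) (x : Fin m → Bool) : 0 < P.mass m x := by
  have h0 := P.θ₀_pos
  have h1 := P.θ₀_lt_θ₁
  have h2 := P.θ₁_lt_one
  have h3 := P.α_le_half
  exact add_pos (mul_pos (by linarith) (flipsMass_pos m h0 (by linarith) x))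
    (mul_pos P.α_pos (flipsMass_pos m (by linarith) h2 x))

theorem CoinProblem.sum_mass (P : CoinProblem) (m : ℕ) : ∑ x, P.mass m x = 1 := by
  simp only [mass, Finset.sum_add_distrib, ← Finset.mul_sum, sum_flipsMass]
  ring

theorem CoinProblem.θStar_mem_Icc (P : CoinProblem) : P.θStar ∈ Set.Icc (P.θ₀ : ℝ) P.θ₁ := by
  have h0 := P.θ₀_pos
  have h1 := P.θ₀_lt_θ₁
  have h2 := P.θ₁_lt_one
  have h3 := P.α_le_half
  have h4 := P.α_pos
  have hle : logit P.θ₀ ≤ logit P.θ₁ := by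
    rw [← Real.sigmoid_le_iff, sigmoid_logit h0 (by linarith), sigmoid_logit (by linarith) h2]
    exact h1.le
  constructor
  · rw [← sigmoid_logit h0 (by linarith), CoinProblem.θStar, Real.sigmoid_le_iff]
    nlinarith
  · rw [← sigmoid_logit (by linarith : 0 < (P.θ₁ : ℝ)) h2, CoinProblem.θStar,
      Real.sigmoid_le_iff]
    nlinarith

/-- The lower bound for a finite expectation and a positive error probability. -/
theorem FixedProcedure.mul_neg_log_le {m : ℕ} (hm : 1 ≤ m) (A : FixedProcedure m) {δ : ℝ}
    (hδ : 0 < δ) (hA : A.IsProbablyDetecting δ) (P : CoinProblem)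
    (hsep : 2 * ((P.θ₁ : ℝ) - P.θ₀) ≤
      min ((P.θ₀ : ℝ) * (1 - P.θ₀)) ((P.θ₁ : ℝ) * (1 - P.θ₁)))
    (hmv : (m : ℝ) ≤ P.θStar * (1 - P.θStar) / ((P.θ₁ : ℝ) - P.θ₀) ^ 2)
    (hfin : A.expectedNumCoins P ≠ ⊤) :
    1 / 130 * min (1 / (m : ℝ)) (P.θStar * (1 - P.θStar)) /
      (m * ((P.α : ℝ) * (1 - P.α) *
        (((P.θ₁ : ℝ) - P.θ₀) ^ 2 / (P.θStar * (1 - P.θStar)))) ^ 2) * -Real.log δ ≤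
      (A.expectedNumCoins P).toReal := by
  have h0 := P.θ₀_pos
  have h1 := P.θ₀_lt_θ₁
  have h2 := P.θ₁_lt_one
  have h3 := P.α_le_half
  have h4 := P.α_pos
  have ht := P.θStar_mem_Icc
  have ht0 : 0 < P.θStar := by linarith [ht.1]
  have ht1 : P.θStar < 1 := by linarith [ht.2]
  have hv : 0 < P.θStar * (1 - P.θStar) := mul_pos ht0 (by linarith)
  have hΔ : 0 < ((P.θ₁ : ℝ) - P.θ₀) ^ 2 := pow_pos (by linarith) 2
  have hm0 : (0 : ℝ) < m := by exact_mod_cast hm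
  have hchi := chiSq_mixture_le hm h4.le (by linarith) h0 h1 h2 hsep ht (logit_sigmoid _) (by
    rw [← mul_div_assoc, div_le_one hv]
    rwa [le_div_iff₀ hΔ] at hmv)
  have hK : 0 < (P.α : ℝ) * (1 - P.α) *
      (((P.θ₁ : ℝ) - P.θ₀) ^ 2 / (P.θStar * (1 - P.θStar))) :=
    mul_pos (mul_pos h4 (by linarith)) (div_pos hΔ hv)
  have hw : 0 < min (1 / (m : ℝ)) (P.θStar * (1 - P.θStar)) := lt_min (by positivity) hv
  have hmain := A.weights.neg_log_le_mul (P.mass_pos m) (flipsMass_pos m ht0 ht1) (P.sum_mass m)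
    (sum_flipsMass m _) hδ (D := 130 * (m * ((P.α : ℝ) * (1 - P.α) *
      (((P.θ₁ : ℝ) - P.θ₀) ^ 2 / (P.θStar * (1 - P.θStar)))) ^ 2 /
        min (1 / (m : ℝ)) (P.θStar * (1 - P.θStar)))) (by positivity)
    (le_trans (neg_le_neg hchi)
      (sum_mul_log_div_ge (P.mass_pos m) (flipsMass_pos m ht0 ht1) (P.sum_mass m)))
    (fun T => A.sum_stopMass_flipsMass_le hA ht0 ht1 (T + 1))
    (fun T => (ENNReal.ofReal_le_iff_le_toReal hfin).1 (A.ofReal_sum_aliveMass_le P T))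
  generalize (P.α : ℝ) * (1 - P.α) *
    (((P.θ₁ : ℝ) - P.θ₀) ^ 2 / (P.θStar * (1 - P.θStar))) = K at *
  generalize min (1 / (m : ℝ)) (P.θStar * (1 - P.θStar)) = w at *
  have hc : 0 ≤ 1 / 130 * w / (m * K ^ 2) := by positivity
  refine (mul_le_mul_of_nonneg_left hmain hc).trans_eq ?_
  field_simp

theorem mainTheorem4 :
    ∃ c : ℝ, 0 < c ∧
      ∀ (δ : ℝ) (_ : 0 ≤ δ) (_ : δ ≤ 1) (m : ℕ) (_ : 1 ≤ m) (A : FixedProcedure m)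
        (_ : A.IsProbablyCorrect δ ∨ A.IsProbablyDetecting δ)
        (P : CoinProblem)
        (_ : 2 * ((P.θ₁ : ℝ) - P.θ₀) ≤
          min ((P.θ₀ : ℝ) * (1 - P.θ₀)) ((P.θ₁ : ℝ) * (1 - P.θ₁))),
        P.θStar ∈ Set.Icc (P.θ₀ : ℝ) P.θ₁ ∧
        ((m : ℝ) ≤ P.θStar * (1 - P.θStar) / ((P.θ₁ : ℝ) - P.θ₀) ^ 2 →
          ((c * min (1 / (m : ℝ)) (P.θStar * (1 - P.θStar)) /
              (m * ((P.α : ℝ) * (1 - P.α) *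
                (((P.θ₁ : ℝ) - P.θ₀) ^ 2 / (P.θStar * (1 - P.θStar)))) ^ 2) : ℝ) : EReal) *
              ENNReal.log (ENNReal.ofReal δ)⁻¹ ≤
            (A.expectedNumCoins P : EReal)) := by
  refine ⟨1 / 130, by norm_num, fun δ hδ0 _ m hm A hA P hsep => ⟨P.θStar_mem_Icc, fun hmv => ?_⟩⟩
  have hdet : A.IsProbablyDetecting δ := hA.elim (·.isProbablyDetecting) id
  by_cases hfin : A.expectedNumCoins P = ⊤
  · rw [hfin, EReal.coe_ennreal_top]
    exact le_top
  -- Detection at level `δ` implies it at every larger level, which also gives access to `δ = 0`.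
  have hbound : ∀ ε, 0 < ε → δ ≤ ε → _ := fun ε hε hle =>
    A.mul_neg_log_le hm hε (fun Q => by linarith [hdet Q]) P hsep hmv hfin
  have hcoef : 0 < 1 / 130 * min (1 / (m : ℝ)) (P.θStar * (1 - P.θStar)) /
      (m * ((P.α : ℝ) * (1 - P.α) *
        (((P.θ₁ : ℝ) - P.θ₀) ^ 2 / (P.θStar * (1 - P.θStar)))) ^ 2) := by
    have h0 := P.θ₀_pos
    have h1 := P.θ₀_lt_θ₁
    have h2 := P.θ₁_lt_one
    have h3 := P.α_le_half
    have h4 := P.α_pos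
    have ht := P.θStar_mem_Icc
    have hv : 0 < P.θStar * (1 - P.θStar) :=
      mul_pos (by linarith [ht.1]) (by linarith [ht.2])
    have hm0 : (0 : ℝ) < m := by exact_mod_cast hm
    have hw : 0 < min (1 / (m : ℝ)) (P.θStar * (1 - P.θStar)) := lt_min (by positivity) hv
    have hα : 0 < 1 - (P.α : ℝ) := by linarith
    have hΔ : 0 < (P.θ₁ : ℝ) - P.θ₀ := by linarith
    positivity
  generalize 1 / 130 * min (1 / (m : ℝ)) (P.θStar * (1 - P.θStar)) /
      (m * ((P.α : ℝ) * (1 - P.α) *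
        (((P.θ₁ : ℝ) - P.θ₀) ^ 2 / (P.θStar * (1 - P.θStar)))) ^ 2) = C at *
  rcases hδ0.eq_or_lt with rfl | hδ
  · exfalso
    -- This level makes the lower bound equal to `E[N] + 1`, so a finite expectation is impossible
    -- when `δ = 0`.
    have h := hbound (Real.exp (-((A.expectedNumCoins P).toReal + 1) / C)) (Real.exp_pos _)
      (Real.exp_pos _).le
    rw [Real.log_exp, neg_div, neg_neg, mul_div_cancel₀ _ hcoef.ne'] at h
    linarith
  · have h := hbound δ hδ le_rfl
    rw [ENNReal.log_inv, ENNReal.log_ofReal_of_pos hδ, ← EReal.coe_neg, ← EReal.coe_mul,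
      ← ENNReal.ofReal_toReal hfin, EReal.coe_ennreal_ofReal, EReal.coe_le_coe_iff]
    exact h.trans (le_max_left _ _)

end
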